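/- Let $(X,d)$ be a non-empty compact metric space and $T:X\to X$ a continuous map. For $n\ge 1$ put $S_n\varphi=\sum_{j=0}^{n-1}\varphi\circ T^j$, $d_n(x,y)=\max_{0\le j<n}d(T^jx,T^jy)$ and $B_n(x,\epsilon)=\{y\in X: d_n(x,y)<\epsilon\}$. For $\varphi\in C(X,\mathbb R)$ let $$R_n(\varphi,\epsilon)=\inf\Big\{\sum_{i=1}^{k}(1/\epsilon)^{\sup_{U_i}S_n\varphi}\Big\},$$ the infimum being over all finite open covers $X=U_1\cup\dots\cup U_k$ by non-empty sets with $\operatorname{diam}(U_i,d_n)<\epsilon$ for all $i$, and let $$\overline{\mathrm{mdim}}_M(T,\varphi,d)=\limsup_{\epsilon\to0^+}\frac{1}{\log(1/\epsilon)}\lim_{n\to\infty}\frac{\log R_n(\varphi,\epsilon)}{n}\in[-\infty,\infty]$$ be the upper metric mean dimension with potential $\varphi$. For a Borel probability measure $\mu$ on $X$ (not assumed $T$-invariant) let $$F(\mu)=\inf\Big\{\int g\,d\mu:\ g\in C(X,\mathbb R),\ \overline{\mathrm{mdim}}_M(T,-g,d)=0\Big\}\in[-\infty,\infty],$$ and call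 $\mu$ an equilibrium state of $\varphi$ if $\overline{\mathrm{mdim}}_M(T,\varphi,d)=F(\mu)+\int\varphi\,d\mu$. For $f\in C(X,\mathbb R)$ with $f>0$, $\epsilon>0$ and $t\in\mathbb R$ let $$m_\epsilon(t)=\lim_{N\to\infty}\inf\Big\{\sum_{i}\exp\Big(-t\sup_{y\in B_{n_i}(x_i,\epsilon)}S_{n_i}f(y)\Big)\Big\},$$ the infimum being over all finite or countable covers $\{B_{n_i}(x_i,\epsilon)\}_i$ of $X$ with all $n_i\ge N$. The BS metric mean dimension of $X$ with respect to $f$ is $$\overline{\mathrm{BSmdim}}_{M,X,T}(f,d)=\limsup_{\epsilon\to0^+}\frac{\inf\{t\in\mathbb R: m_\epsilon(t)=0\}}{\log(1/\epsilon)}.$$ **Corollary.** Suppose that $\overline{\mathrm{mdim}}_M(T,0,d)<\infty$ and that $f\in C(X,\mathbb R)$ satisfies $f>0$. Then there is a unique $s_0\ge0$ with $\overline{\mathrm{mdim}}_M(T,-s_0f,d)=0$, and for every equilibrium state $\mu$ of $-s_0f$, $$\overline{\mathrm{BSmdim}}_{M,X,T}(f,d)=\frac{F(\mu)}{\int f\,d\mu}.$$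 -/

import Mathlib

open Filter Topology MeasureTheory

noncomputable section

namespace MetricMeanDim

variable {X : Type*} [MetricSpace X]

/-- The Bowen metric `d_n(x, y) = max_{0 ≤ j < n} d(T^j x, T^j y)`. -/
def bowenDist (T : X → X) (n : ℕ) (x y : X) : ℝ :=
  ⨆ j : Fin n, dist (T^[j] x) (T^[j] y)

/-- The open Bowen ball `B_n(x, ε) = {y | d_n(x, y) < ε}`. -/
def bowenBall (T : X → X) (n : ℕ) (x : X) (ε : ℝ) : Set X :=
  {y | bowenDist T n x y < ε}

/-- The diameter of `U` in the Bowen metric `d_n`. -/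
def bowenDiam (T : X → X) (n : ℕ) (U : Set X) : ℝ :=
  ⨆ p : U × U, bowenDist T n p.1 p.2

/-- The quantity `R_n(X, f, d, ε)`: the infimum of `∑ i, (1/ε) ^ (sup_{U i} S_n f)` over the finite
open covers `U` of `X` whose members have `d_n`-diameter less than `ε`. (Members are taken non-empty,
so that each supremum is a genuine one; empty members could only enlarge the sum.) -/
def coverSum (T : X → X) (f : C(X, ℝ)) (n : ℕ) (ε : ℝ) : ℝ :=
  sInf {r : ℝ | ∃ (k : ℕ) (U : Fin k → Set X),
    (∀ i, IsOpen (U i) ∧ (U i).Nonempty ∧ bowenDiam T n (U i) < ε) ∧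
    (⋃ i, U i) = Set.univ ∧
    r = ∑ i, (1 / ε) ^ (⨆ x : U i, birkhoffSum T f n (x : X))}

/-- `R(X, f, d, ε) = lim_{n → ∞} (1/n) log R_n(X, f, d, ε)`. For `0 < ε < 1` the sequence
`log R_n` is subadditive, so the limit exists and is the upper limit written here. -/
def coverGrowth (T : X → X) (f : C(X, ℝ)) (ε : ℝ) : EReal :=
  limsup (fun n : ℕ => ((Real.log (coverSum T f n ε) / n : ℝ) : EReal)) atTop

/-- The upper metric mean dimension with potential `f`:
`limsup_{ε → 0+} R(X, f, d, ε) / log (1/ε)`. -/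
def upperMdim (T : X → X) (f : C(X, ℝ)) : EReal :=
  limsup (fun ε : ℝ => coverGrowth T f ε / ((Real.log (1 / ε) : ℝ) : EReal)) (𝓝[>] 0)

/-- The set `𝒜` of the continuous `g` for which `-g` has upper metric mean dimension zero. -/
def zeroPotentials (T : X → X) : Set C(X, ℝ) :=
  {g | upperMdim T (-g) = 0}

/-- The upper measure-theoretical metric mean dimension `F(μ) = inf_{g ∈ 𝒜} ∫ g dμ`. It is an
extended real: it is `-∞` for many measures that are not invariant. -/
def measureMdim [MeasurableSpace X] (T : X → X) (μ : ProbabilityMeasure X) : EReal :=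
  ⨅ g ∈ zeroPotentials T, ((∫ x, g x ∂(μ : Measure X) : ℝ) : EReal)

/-- The set of equilibrium states for `f`: the Borel probability measures `μ`, not assumed
invariant, such that the upper metric mean dimension with potential `f` is `F(μ) + ∫ f dμ`. -/
def equilibriumStates [MeasurableSpace X] (T : X → X) (f : C(X, ℝ)) :
    Set (ProbabilityMeasure X) :=
  {μ | upperMdim T f = measureMdim T μ + ((∫ x, f x ∂(μ : Measure X) : ℝ) : EReal)}

/-- The infimum of `∑ i, exp (-t sup_{B_{n_i}(x_i, ε)} S_{n_i} f)` over the countable covers of `Z`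
by Bowen balls `B_{n_i}(x_i, ε)` with all `n_i ≥ N`. A cover is given by its set of pairs
`(x_i, n_i)`. -/
def bsSum (T : X → X) (f : C(X, ℝ)) (Z : Set X) (ε t : ℝ) (N : ℕ) : ENNReal :=
  ⨅ (C : Set (X × ℕ)) (_ : C.Countable ∧ (∀ p ∈ C, N ≤ p.2) ∧ Z ⊆ ⋃ p ∈ C, bowenBall T p.2 p.1 ε),
    ∑' p : C, ENNReal.ofReal
      (Real.exp (-t * ⨆ y : bowenBall T p.1.2 p.1.1 ε, birkhoffSum T f p.1.2 (y : X)))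

/-- The outer measure of `Z` at scale `ε` with exponent `t`: the limit of the nondecreasing
sequence `bsSum T f Z ε t N` as `N → ∞`. -/
def bsMeasure (T : X → X) (f : C(X, ℝ)) (Z : Set X) (ε t : ℝ) : ENNReal :=
  ⨆ N : ℕ, bsSum T f Z ε t N

/-- The critical exponent of `Z` at scale `ε`. -/
def bsCritical (T : X → X) (f : C(X, ℝ)) (Z : Set X) (ε : ℝ) : EReal :=
  ⨅ (t : ℝ) (_ : bsMeasure T f Z ε t = 0), (t : EReal)

/-- The BS (Barreira-Schmeling) metric mean dimension of `Z` with respect to `f`: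
`limsup_{ε → 0+}` of the critical exponent at scale `ε` divided by `log (1/ε)`. -/
def bsMdim (T : X → X) (f : C(X, ℝ)) (Z : Set X) : EReal :=
  limsup (fun ε : ℝ => bsCritical T f Z ε / ((Real.log (1 / ε) : ℝ) : EReal)) (𝓝[>] 0)

end MetricMeanDim

end

/-!
The corollary is Bowen's equation for the BS metric mean dimension. Let `f > 0` and write
`P(s) = upperMdim T (-s f)`.

*The zero of `P`.* Adding a constant `c` to the potential changes `coverGrowth` at scale `ε` by at most
`c log (1/ε)`, hence `upperMdim` by at most `c`. As `f` is bounded above and bounded away from `0`, `P` is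
finite, Lipschitz and strictly decreasing at a linear rate; since `P(0) ≥ 0`, it has exactly one zero
`s₀ ≥ 0` (`existsUnique_upperMdim_eq_zero`).

*`bsMdim ≤ s₀`.* The weight `(1/ε) ^ (-s S_n f)` equals `exp (-t S_n f)` with `t = s log (1/ε)`, and a
set of `d_n`-diameter less than `ε` lies in the Bowen ball around any of its points. If `P(s) < 0`, the
sums over covers of length `n` decay exponentially in `n` at all small scales, and so the outer measure
with exponent `t` vanishes (`bsMdim_le_of_upperMdim_neg`).

*`bsMdim ≥ s₀`.* If the outer measure with exponent `t` vanishes at scale `ε`, compactness gives a finite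
cover by Bowen balls of varying lengths with total weight at most `1`. Concatenating these balls codes
every orbit segment of a given length `n`; by strong induction on `n` this produces covers of length `n`
at scale `3 ε` whose sums grow at most like `exp (t γ n)`, where `γ` is the oscillation of `f` at scale
`2 ε` (`coverBound_of_weights`). Since `γ → 0` with `ε`, `bsMdim < s'` would force `P(s') ≤ 0`
(`upperMdim_nonpos_of_bsMdim_lt`), which is impossible for `s' < s₀`.

For an equilibrium state `μ` of `-s₀ f` the definition reads `0 = F(μ) - s₀ ∫ f dμ` with `∫ f dμ > 0`, so
`F(μ) / ∫ f dμ = s₀`.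
-/

universe u

namespace MetricMeanDim

/-! ### Bowen distances, balls and Birkhoff sums -/

lemma bowenDist_le {X : Type*} [MetricSpace X] {T : X → X} {n : ℕ} {x y : X} {δ : ℝ} (hδ : 0 ≤ δ)
    (h : ∀ j < n, dist (T^[j] x) (T^[j] y) ≤ δ) : bowenDist T n x y ≤ δ :=
  Real.iSup_le (fun j => h j j.2) hδ

lemma dist_iterate_le_bowenDist {X : Type*} [MetricSpace X] (T : X → X) {n j : ℕ} (hj : j < n)
    (x y : X) : dist (T^[j] x) (T^[j] y) ≤ bowenDist T n x y :=
  le_ciSup (f := fun j : Fin n => dist (T^[j] x) (T^[j] y)) (Set.finite_range _).bddAbove ⟨j, hj⟩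

lemma bowenDist_lt_iff {X : Type*} [MetricSpace X] {T : X → X} {n : ℕ} {x y : X} {ε : ℝ}
    (hε : 0 < ε) : bowenDist T n x y < ε ↔ ∀ j < n, dist (T^[j] x) (T^[j] y) < ε := by
  refine ⟨fun h j hj => (dist_iterate_le_bowenDist T hj x y).trans_lt h, fun h => ?_⟩
  rcases Nat.eq_zero_or_pos n with rfl | hn
  · simpa [bowenDist] using hε
  · have : Nonempty (Fin n) := ⟨⟨0, hn⟩⟩
    obtain ⟨j, hj⟩ := exists_eq_ciSup_of_finite (f := fun j : Fin n => dist (T^[j] x) (T^[j] y))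
    rw [bowenDist, ← hj]
    exact h j j.2

lemma isOpen_bowenBall {X : Type*} [MetricSpace X] {T : X → X} (hT : Continuous T) (n : ℕ) (x : X)
    {ε : ℝ} (hε : 0 < ε) : IsOpen (bowenBall T n x ε) := by
  have : bowenBall T n x ε = ⋂ j : Fin n, {y | dist (T^[j] x) (T^[j] y) < ε} := by
    ext y
    simp [bowenBall, bowenDist_lt_iff hε, Fin.forall_iff]
  rw [this]
  exact isOpen_iInter_of_finite fun j =>
    isOpen_lt (continuous_const.dist (hT.iterate j)) continuous_const

lemma mem_bowenBall_self {X : Type*} [MetricSpace X] (T : X → X) (n : ℕ) (x : X) {ε : ℝ}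
    (hε : 0 < ε) : x ∈ bowenBall T n x ε := by
  simp [bowenBall, bowenDist_lt_iff hε, hε]

lemma bowenDist_le_bowenDiam {X : Type*} [MetricSpace X] [CompactSpace X] (T : X → X) (n : ℕ)
    {U : Set X} {x y : X} (hx : x ∈ U) (hy : y ∈ U) : bowenDist T n x y ≤ bowenDiam T n U := by
  refine le_ciSup (f := fun p : U × U => bowenDist T n p.1 p.2) ⟨Metric.diam (Set.univ : Set X), ?_⟩
    (⟨x, hx⟩, ⟨y, hy⟩)
  rintro _ ⟨p, rfl⟩
  exact bowenDist_le Metric.diam_nonneg fun j _ =>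
    Metric.dist_le_diam_of_mem isCompact_univ.isBounded (Set.mem_univ _) (Set.mem_univ _)

lemma bowenDiam_le {X : Type*} [MetricSpace X] {T : X → X} {n : ℕ} {U : Set X} {δ : ℝ} (hδ : 0 ≤ δ)
    (h : ∀ x ∈ U, ∀ y ∈ U, ∀ j < n, dist (T^[j] x) (T^[j] y) ≤ δ) : bowenDiam T n U ≤ δ :=
  Real.iSup_le (fun p => bowenDist_le hδ (h _ p.1.2 _ p.2.2)) hδ

lemma birkhoffSum_mono {X : Type*} (T : X → X) {φ ψ : X → ℝ} (h : ∀ x, φ x ≤ ψ x) (n : ℕ) (x : X) :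
    birkhoffSum T φ n x ≤ birkhoffSum T ψ n x :=
  Finset.sum_le_sum fun _ _ => h _

lemma birkhoffSum_nonneg {X : Type*} (T : X → X) {φ : X → ℝ} (h : ∀ x, 0 ≤ φ x) (n : ℕ) (x : X) :
    0 ≤ birkhoffSum T φ n x :=
  Finset.sum_nonneg fun _ _ => h _

lemma birkhoffSum_add_const {X : Type*} (T : X → X) (φ : X → ℝ) (c : ℝ) (n : ℕ) (x : X) :
    birkhoffSum T (fun y => φ y + c) n x = birkhoffSum T φ n x + n * c := by
  simp [birkhoffSum, Finset.sum_add_distrib]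

lemma birkhoffSum_smul {X : Type*} [TopologicalSpace X] (T : X → X) (f : C(X, ℝ)) (s : ℝ) (n : ℕ)
    (x : X) : birkhoffSum T (s • f : C(X, ℝ)) n x = s * birkhoffSum T f n x := by
  simp [birkhoffSum, Finset.mul_sum]

lemma abs_birkhoffSum_le {X : Type*} [TopologicalSpace X] [CompactSpace X] (T : X → X) (f : C(X, ℝ))
    (n : ℕ) (x : X) : |birkhoffSum T f n x| ≤ n * ‖f‖ := by
  refine (Finset.abs_sum_le_sum_abs _ _).trans ?_
  refine (Finset.sum_le_card_nsmul _ _ ‖f‖ fun j _ => f.norm_coe_le_norm _).trans ?_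
  simp

lemma bddAbove_birkhoffSum {X : Type*} [TopologicalSpace X] [CompactSpace X] (T : X → X)
    (f : C(X, ℝ)) (n : ℕ) (U : Set X) :
    BddAbove (Set.range fun x : U => birkhoffSum T f n (x : X)) := by
  refine ⟨n * ‖f‖, ?_⟩
  rintro _ ⟨x, rfl⟩
  exact (le_abs_self _).trans (abs_birkhoffSum_le T f n x)

/-! ### Cover sums -/

lemma log_one_div_pos {ε : ℝ} (h0 : 0 < ε) (h1 : ε < 1) : 0 < Real.log (1 / ε) :=
  Real.log_pos ((one_lt_div h0).2 h1)

lemma one_div_rpow_eq_exp {ε : ℝ} (h0 : 0 < ε) (c : ℝ) :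
    (1 / ε) ^ c = Real.exp (Real.log (1 / ε) * c) :=
  Real.rpow_def_of_pos (by positivity) c

lemma le_iSup_birkhoffSum {X : Type*} [TopologicalSpace X] [CompactSpace X] (T : X → X)
    (f : C(X, ℝ)) (n : ℕ) {U : Set X} {x : X} (hx : x ∈ U) :
    birkhoffSum T f n x ≤ ⨆ x : U, birkhoffSum T f n (x : X) :=
  le_ciSup (bddAbove_birkhoffSum T f n U) ⟨x, hx⟩

lemma bddBelow_coverSum {X : Type*} [MetricSpace X] (T : X → X) (f : C(X, ℝ)) (n : ℕ) {ε : ℝ}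
    (h0 : 0 < ε) : BddBelow {r : ℝ | ∃ (k : ℕ) (U : Fin k → Set X),
    (∀ i, IsOpen (U i) ∧ (U i).Nonempty ∧ bowenDiam T n (U i) < ε) ∧
    (⋃ i, U i) = Set.univ ∧
    r = ∑ i, (1 / ε) ^ (⨆ x : U i, birkhoffSum T f n (x : X))} := by
  refine ⟨0, ?_⟩
  rintro _ ⟨k, U, -, -, rfl⟩
  exact Finset.sum_nonneg fun i _ => Real.rpow_nonneg (by positivity) _

/-- An upper bound for `coverSum` from a finite open cover indexed by any finite type, in which empty
members are allowed and `c i` is any upper bound of the Birkhoff sum on the `i`-th member. -/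
lemma coverSum_le {X : Type*} [MetricSpace X] {T : X → X} {φ : C(X, ℝ)} {n : ℕ}
    {ε δ : ℝ} (h0 : 0 < ε) (h1 : ε < 1) (hδ : 0 ≤ δ) (hδε : δ < ε) {ι : Type*} [Fintype ι]
    (U : ι → Set X) (c : ι → ℝ) (hopen : ∀ i, IsOpen (U i))
    (hdiam : ∀ i, ∀ x ∈ U i, ∀ y ∈ U i, ∀ j < n, dist (T^[j] x) (T^[j] y) ≤ δ)
    (hcov : ∀ x, ∃ i, x ∈ U i) (hc : ∀ i, ∀ x ∈ U i, birkhoffSum T φ n x ≤ c i) :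
    coverSum T φ n ε ≤ ∑ i, (1 / ε) ^ c i := by
  classical
  let e := (Fintype.equivFin {i // (U i).Nonempty}).symm
  have hmem : (∑ i, (1 / ε) ^ (⨆ x : U (e i), birkhoffSum T φ n (x : X))) ∈
      {r : ℝ | ∃ (k : ℕ) (U : Fin k → Set X),
        (∀ i, IsOpen (U i) ∧ (U i).Nonempty ∧ bowenDiam T n (U i) < ε) ∧
        (⋃ i, U i) = Set.univ ∧
        r = ∑ i, (1 / ε) ^ (⨆ x : U i, birkhoffSum T φ n (x : X))} := by
    refine ⟨_, fun i => U (e i), fun i => ⟨hopen _, (e i).2,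
      (bowenDiam_le hδ (hdiam _)).trans_lt hδε⟩, ?_, rfl⟩
    refine Set.eq_univ_of_forall fun x => ?_
    obtain ⟨i, hi⟩ := hcov x
    exact Set.mem_iUnion.2 ⟨e.symm ⟨i, ⟨x, hi⟩⟩, by simpa using hi⟩
  refine (csInf_le (bddBelow_coverSum T φ n h0) hmem).trans ?_
  have hone : 1 ≤ 1 / ε := ((one_lt_div h0).2 h1).le
  calc ∑ i, (1 / ε) ^ (⨆ x : U (e i), birkhoffSum T φ n (x : X))
      ≤ ∑ i, (1 / ε) ^ c (e i) := by
        refine Finset.sum_le_sum fun i _ => Real.rpow_le_rpow_of_exponent_le hone ?_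
        have : Nonempty (U (e i)) := (e i).2.to_subtype
        exact ciSup_le fun x => hc _ _ x.2
    _ = ∑ i : {i // (U i).Nonempty}, (1 / ε) ^ c i :=
        Equiv.sum_comp e fun i : {i // (U i).Nonempty} => (1 / ε) ^ c i
    _ = ∑ i with (U i).Nonempty, (1 / ε) ^ c i :=
        (Finset.sum_subtype _ (by simp) fun i => (1 / ε) ^ c i).symm
    _ ≤ ∑ i, (1 / ε) ^ c i :=
        Finset.sum_le_sum_of_subset_of_nonneg (Finset.filter_subset _ _)
          fun i _ _ => Real.rpow_nonneg (by positivity) _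

lemma coverSum_set_nonempty {X : Type*} [MetricSpace X] [CompactSpace X] {T : X → X}
    (hT : Continuous T) (f : C(X, ℝ)) (n : ℕ) {ε : ℝ} (h0 : 0 < ε) :
    {r : ℝ | ∃ (k : ℕ) (U : Fin k → Set X),
      (∀ i, IsOpen (U i) ∧ (U i).Nonempty ∧ bowenDiam T n (U i) < ε) ∧
      (⋃ i, U i) = Set.univ ∧
      r = ∑ i, (1 / ε) ^ (⨆ x : U i, birkhoffSum T f n (x : X))}.Nonempty := by
  have h3 : 0 < ε / 3 := by positivity
  obtain ⟨t, ht⟩ := CompactSpace.elim_nhds_subcover (fun x => bowenBall T n x (ε / 3))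
    fun x => (isOpen_bowenBall hT n x h3).mem_nhds (mem_bowenBall_self T n x h3)
  let e := t.equivFin.symm
  refine ⟨_, _, fun i => bowenBall T n (e i : X) (ε / 3), fun i => ⟨isOpen_bowenBall hT n _ h3,
    ⟨_, mem_bowenBall_self T n _ h3⟩, (bowenDiam_le (δ := 2 * (ε / 3)) (by positivity) ?_).trans_lt
      (by linarith)⟩, ?_, rfl⟩
  · intro x hx y hy j hj
    have h1 := (bowenDist_lt_iff h3).1 hx j hj
    have h2 := (bowenDist_lt_iff h3).1 hy j hj
    have := dist_triangle_left (T^[j] x) (T^[j] y) (T^[j] (e i : X))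
    linarith
  · refine Set.eq_univ_of_forall fun x => ?_
    have hx : x ∈ ⋃ x ∈ t, bowenBall T n x (ε / 3) := by rw [ht]; trivial
    simp only [Set.mem_iUnion] at hx ⊢
    obtain ⟨y, hy, hxy⟩ := hx
    exact ⟨e.symm ⟨y, hy⟩, by simpa using hxy⟩

lemma le_coverSum {X : Type*} [MetricSpace X] [CompactSpace X] [Nonempty X] {T : X → X}
    (hT : Continuous T) (φ : C(X, ℝ)) (n : ℕ) {ε a : ℝ} (h0 : 0 < ε) (h1 : ε < 1)
    (ha : ∀ x, a ≤ birkhoffSum T φ n x) : (1 / ε) ^ a ≤ coverSum T φ n ε := by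
  refine le_csInf (coverSum_set_nonempty hT φ n h0) ?_
  rintro _ ⟨k, U, hU, hcov, rfl⟩
  have hone : 1 ≤ 1 / ε := ((one_lt_div h0).2 h1).le
  obtain ⟨x⟩ := ‹Nonempty X›
  obtain ⟨i, hi⟩ := Set.mem_iUnion.1 (hcov ▸ Set.mem_univ x)
  refine le_trans ?_ (Finset.single_le_sum (f := fun i => (1 / ε) ^ (⨆ x : U i,
    birkhoffSum T φ n (x : X))) (fun i _ => Real.rpow_nonneg (by positivity) _) (Finset.mem_univ i))
  exact Real.rpow_le_rpow_of_exponent_le hone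
    ((ha x).trans (le_iSup_birkhoffSum T φ n hi))

lemma coverSum_pos {X : Type*} [MetricSpace X] [CompactSpace X] [Nonempty X] {T : X → X}
    (hT : Continuous T) (φ : C(X, ℝ)) (n : ℕ) {ε : ℝ} (h0 : 0 < ε) (h1 : ε < 1) :
    0 < coverSum T φ n ε :=
  (Real.rpow_pos_of_pos (by positivity) _).trans_le
    (le_coverSum hT φ n h0 h1 fun x => (abs_le.1 (abs_birkhoffSum_le T φ n x)).1)

lemma coverSum_le_mul {X : Type*} [MetricSpace X] [CompactSpace X] {T : X → X}
    (hT : Continuous T) {φ ψ : C(X, ℝ)} {c : ℝ} (h : ∀ x, φ x ≤ ψ x + c) (n : ℕ) {ε : ℝ}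
    (h0 : 0 < ε) (h1 : ε < 1) :
    coverSum T φ n ε ≤ (1 / ε) ^ (n * c) * coverSum T ψ n ε := by
  have hone : 1 ≤ 1 / ε := ((one_lt_div h0).2 h1).le
  have hε : 0 < 1 / ε := by positivity
  rw [← div_le_iff₀' (Real.rpow_pos_of_pos hε _)]
  refine le_csInf (coverSum_set_nonempty hT ψ n h0) ?_
  rintro _ ⟨k, U, hU, hcov, rfl⟩
  rw [div_le_iff₀' (Real.rpow_pos_of_pos hε _), Finset.mul_sum]
  refine (csInf_le (bddBelow_coverSum T φ n h0) ⟨k, U, hU, hcov, rfl⟩).trans ?_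
  refine Finset.sum_le_sum fun i _ => ?_
  rw [← Real.rpow_add hε]
  refine Real.rpow_le_rpow_of_exponent_le hone ?_
  have : Nonempty (U i) := (hU i).2.1.to_subtype
  refine ciSup_le fun x => ?_
  have h2 := birkhoffSum_mono T h n x
  rw [birkhoffSum_add_const] at h2
  have h3 := le_iSup_birkhoffSum T ψ n x.2
  linarith

/-! ### Monotonicity of the metric mean dimension in the potential -/

lemma limsup_le_limsup_add_coe {α : Type*} {l : Filter α} [l.NeBot] {u v : α → EReal} {c : ℝ}
    (h : ∀ᶠ a in l, u a ≤ v a + c) : limsup u l ≤ limsup v l + c := by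
  refine (limsup_le_limsup h).trans ?_
  have := EReal.limsup_add_le (f := l) (u := v) (v := fun _ => (c : EReal))
    (Or.inr (by simp)) (Or.inr (by simp))
  rw [limsup_const] at this
  exact this

lemma coverGrowth_le_add {X : Type*} [MetricSpace X] [CompactSpace X] [Nonempty X] {T : X → X}
    (hT : Continuous T) {φ ψ : C(X, ℝ)} {c : ℝ} (h : ∀ x, φ x ≤ ψ x + c) {ε : ℝ}
    (h0 : 0 < ε) (h1 : ε < 1) :
    coverGrowth T φ ε ≤ coverGrowth T ψ ε + ((c * Real.log (1 / ε) : ℝ) : EReal) := by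
  refine limsup_le_limsup_add_coe ?_
  filter_upwards [eventually_gt_atTop 0] with n hn
  have hn' : (0 : ℝ) < n := by exact_mod_cast hn
  rw [← EReal.coe_add, EReal.coe_le_coe_iff, div_le_iff₀ hn']
  have h2 := Real.log_le_log (coverSum_pos hT φ n h0 h1) (coverSum_le_mul hT h n h0 h1)
  rw [Real.log_mul (Real.rpow_pos_of_pos (by positivity) _).ne' (coverSum_pos hT ψ n h0 h1).ne',
    Real.log_rpow (by positivity)] at h2
  have : Real.log (coverSum T ψ n ε) / n * n = Real.log (coverSum T ψ n ε) := by field_simp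
  linarith [this]

lemma eventually_scale {δ : ℝ} (hδ : 0 < δ) : ∀ᶠ ε : ℝ in 𝓝[>] 0, 0 < ε ∧ ε < δ :=
  Ioo_mem_nhdsGT hδ

lemma upperMdim_le_add {X : Type*} [MetricSpace X] [CompactSpace X] [Nonempty X] {T : X → X}
    (hT : Continuous T) {φ ψ : C(X, ℝ)} {c : ℝ} (h : ∀ x, φ x ≤ ψ x + c) :
    upperMdim T φ ≤ upperMdim T ψ + c := by
  refine limsup_le_limsup_add_coe ?_
  filter_upwards [eventually_scale one_pos] with ε ⟨h0, h1⟩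
  have hL := log_one_div_pos h0 h1
  refine (EReal.div_le_div_right_of_nonneg (EReal.coe_nonneg.2 hL.le)
    (coverGrowth_le_add hT h h0 h1)).trans ?_
  rw [EReal.add_div_of_nonneg_right (EReal.coe_nonneg.2 hL.le), ← EReal.coe_div,
    mul_div_cancel_right₀ _ hL.ne']

lemma upperMdim_zero_nonneg {X : Type*} [MetricSpace X] [CompactSpace X] [Nonempty X] {T : X → X}
    (hT : Continuous T) : 0 ≤ upperMdim T (0 : C(X, ℝ)) := by
  refine le_limsup_of_frequently_le (Eventually.frequently ?_)
  filter_upwards [eventually_scale one_pos] with ε ⟨h0, h1⟩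
  refine EReal.div_nonneg ?_ (EReal.coe_nonneg.2 (log_one_div_pos h0 h1).le)
  refine le_limsup_of_frequently_le (Eventually.frequently (Eventually.of_forall fun n => ?_))
  refine EReal.coe_nonneg.2 (div_nonneg (Real.log_nonneg ?_) n.cast_nonneg)
  simpa using le_coverSum hT (0 : C(X, ℝ)) n (a := 0) h0 h1 (by simp [birkhoffSum])

lemma exists_pos_bounds {X : Type*} [TopologicalSpace X] [CompactSpace X] [Nonempty X]
    (f : C(X, ℝ)) (hf : ∀ x, 0 < f x) :
    ∃ m M : ℝ, 0 < m ∧ 0 < M ∧ ∀ x, m ≤ f x ∧ f x ≤ M := by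
  obtain ⟨a, ha⟩ := f.continuous.exists_forall_le' (Classical.arbitrary X) (by simp)
  obtain ⟨b, hb⟩ := f.continuous.exists_forall_ge' (Classical.arbitrary X) (by simp)
  exact ⟨f a, f b, hf a, hf b, fun x => ⟨ha x, hb x⟩⟩

/-- The function `s ↦ upperMdim T (-s f)` decreases at rate at least `m > 0`. -/
lemma upperMdim_neg_smul_le {X : Type*} [MetricSpace X] [CompactSpace X] [Nonempty X] {T : X → X}
    (hT : Continuous T) {f : C(X, ℝ)} {m : ℝ} (hm : ∀ x, m ≤ f x) {s t : ℝ} (hst : s ≤ t) :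
    upperMdim T ((-t) • f) ≤ upperMdim T ((-s) • f) + ((-((t - s) * m) : ℝ) : EReal) := by
  refine upperMdim_le_add hT fun x => ?_
  have := mul_le_mul_of_nonneg_left (hm x) (sub_nonneg.2 hst)
  simp only [ContinuousMap.smul_apply, smul_eq_mul]
  linarith

lemma upperMdim_le_neg_smul {X : Type*} [MetricSpace X] [CompactSpace X] [Nonempty X] {T : X → X}
    (hT : Continuous T) {f : C(X, ℝ)} {M : ℝ} (hM : ∀ x, f x ≤ M) {s t : ℝ} (hst : s ≤ t) :
    upperMdim T ((-s) • f) ≤ upperMdim T ((-t) • f) + (((t - s) * M : ℝ) : EReal) := by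
  refine upperMdim_le_add hT fun x => ?_
  have := mul_le_mul_of_nonneg_left (hM x) (sub_nonneg.2 hst)
  simp only [ContinuousMap.smul_apply, smul_eq_mul]
  linarith

/-- The pressure-like function `s ↦ upperMdim T (-s f)` is real valued, Lipschitz and strictly
decreasing with limit `-∞`, and nonnegative at `0`; its zero comes from the intermediate value
theorem. -/
lemma existsUnique_upperMdim_eq_zero {X : Type*} [MetricSpace X] [CompactSpace X] [Nonempty X]
    {T : X → X} (hT : Continuous T) (hfin : upperMdim T (0 : C(X, ℝ)) < ⊤) (f : C(X, ℝ))
    (hf : ∀ x, 0 < f x) : ∃! s₀ : ℝ, 0 ≤ s₀ ∧ upperMdim T ((-s₀) • f) = 0 := by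
  obtain ⟨m, M, hm, hM, hb⟩ := exists_pos_bounds f hf
  have hpos := upperMdim_zero_nonneg hT
  have hdec := fun s t : ℝ => upperMdim_neg_smul_le (s := s) (t := t) hT fun x => (hb x).1
  have hlip := fun s t : ℝ => upperMdim_le_neg_smul (s := s) (t := t) hT fun x => (hb x).2
  have hz : upperMdim T ((-0 : ℝ) • f) = upperMdim T (0 : C(X, ℝ)) := by simp
  have hreal : ∀ s : ℝ, 0 ≤ s → ((upperMdim T ((-s) • f)).toReal : EReal) =
      upperMdim T ((-s) • f) := by
    intro s hs
    refine EReal.coe_toReal (fun h => ?_) (fun h => ?_)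
    · have := (hdec 0 s hs).trans_lt (EReal.add_lt_top (by rw [hz]; exact hfin.ne) (EReal.coe_ne_top _))
      exact this.ne h
    · have := hlip 0 s hs
      rw [h, hz, EReal.bot_add, le_bot_iff] at this
      simp [this] at hpos
  set p : ℝ → ℝ := fun s => (upperMdim T ((-s) • f)).toReal with hp
  have hdec' : ∀ s t, 0 ≤ s → s ≤ t → p t ≤ p s - (t - s) * m := by
    intro s t hs hst
    have := hdec s t hst
    rw [← hreal s hs, ← hreal t (hs.trans hst), ← EReal.coe_add, EReal.coe_le_coe_iff] at this
    simp only [hp]; linarith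
  have hlip' : ∀ s t, 0 ≤ s → s ≤ t → p s ≤ p t + (t - s) * M := by
    intro s t hs hst
    have := hlip s t hst
    rwa [← hreal s hs, ← hreal t (hs.trans hst), ← EReal.coe_add, EReal.coe_le_coe_iff] at this
  have hp0 : 0 ≤ p 0 := by
    have := hreal 0 le_rfl
    rw [hz] at this
    rw [← this, ← EReal.coe_zero, EReal.coe_le_coe_iff] at hpos
    simpa [hp] using hpos
  have hcont : ContinuousOn p (Set.Icc 0 (p 0 / m)) := by
    refine LipschitzOnWith.continuousOn (K := M.toNNReal) (LipschitzOnWith.of_dist_le_mul ?_)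
    intro s hs t ht
    rw [Real.coe_toNNReal _ hM.le, Real.dist_eq, Real.dist_eq]
    rcases le_total s t with h | h
    · have h1 := hdec' s t hs.1 h
      have h2 := hlip' s t hs.1 h
      have h3 : 0 ≤ (t - s) * m := mul_nonneg (sub_nonneg.2 h) hm.le
      rw [abs_of_nonneg (by linarith), abs_of_nonpos (by linarith)]
      linarith
    · have h1 := hdec' t s ht.1 h
      have h2 := hlip' t s ht.1 h
      have h3 : 0 ≤ (s - t) * m := mul_nonneg (sub_nonneg.2 h) hm.le
      rw [abs_of_nonpos (by linarith), abs_of_nonneg (by linarith)]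
      linarith
  have hq : 0 ≤ p 0 / m := div_nonneg hp0 hm.le
  have hend : p (p 0 / m) ≤ 0 := by
    have := hdec' 0 _ le_rfl hq
    rwa [sub_zero, div_mul_cancel₀ _ hm.ne', sub_self] at this
  obtain ⟨s₀, hs, hps⟩ := intermediate_value_Icc' hq hcont ⟨hend, hp0⟩
  refine ⟨s₀, ⟨hs.1, ?_⟩, ?_⟩
  · rw [← hreal s₀ hs.1]
    exact_mod_cast hps
  · rintro t ⟨ht, hpt⟩
    have hpt' : p t = 0 := by simp only [hp]; rw [hpt, EReal.toReal_zero]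
    rcases lt_trichotomy t s₀ with h | h | h
    · nlinarith [hdec' t s₀ ht h.le, mul_pos (sub_pos.2 h) hm]
    · exact h
    · nlinarith [hdec' s₀ t hs.1 h.le, mul_pos (sub_pos.2 h) hm]

/-! ### Upper bound for the critical exponents -/

/-- Each member of a cover with small `d_n`-diameter lies in the Bowen ball around any of its points,
so the sums defining `coverSum` dominate those defining `bsSum` for all `N ≤ n`. -/
lemma bsSum_le_ofReal {X : Type*} [MetricSpace X] [CompactSpace X] {T : X → X}
    (hT : Continuous T) (f : C(X, ℝ)) {s ε r : ℝ} (hs : 0 ≤ s) (h0 : 0 < ε) (h1 : ε < 1) {n N : ℕ}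
    (hN : N ≤ n) (hr : coverSum T ((-s) • f) n ε < r) :
    bsSum T f Set.univ ε (s * Real.log (1 / ε)) N ≤ ENNReal.ofReal r := by
  classical
  have hL := log_one_div_pos h0 h1
  obtain ⟨_, ⟨k, U, hU, hcov, rfl⟩, hlt⟩ :=
    exists_lt_of_csInf_lt (coverSum_set_nonempty hT ((-s) • f) n h0) hr
  choose x hx using fun i => (hU i).2.1
  let C : Finset (X × ℕ) := Finset.univ.image fun i => (x i, n)
  let w : X × ℕ → ENNReal := fun p => ENNReal.ofReal (Real.exp (-(s * Real.log (1 / ε)) *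
    ⨆ y : bowenBall T p.2 p.1 ε, birkhoffSum T f p.2 (y : X)))
  have hC : (C : Set (X × ℕ)).Countable ∧ (∀ p ∈ (C : Set (X × ℕ)), N ≤ p.2) ∧
      Set.univ ⊆ ⋃ p ∈ (C : Set (X × ℕ)), bowenBall T p.2 p.1 ε := by
    refine ⟨C.countable_toSet, fun p hp => ?_, fun y hy => ?_⟩
    · obtain ⟨i, -, rfl⟩ := Finset.mem_image.1 hp
      exact hN
    rw [← hcov] at hy
    obtain ⟨i, hi⟩ := Set.mem_iUnion.1 hy
    refine Set.mem_iUnion₂.2 ⟨(x i, n), Finset.mem_image.2 ⟨i, Finset.mem_univ i, rfl⟩, ?_⟩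
    exact (bowenDist_le_bowenDiam T n (hx i) hi).trans_lt (hU i).2.2
  refine (iInf₂_le (C : Set (X × ℕ)) hC).trans ?_
  calc ∑' p : C, w p = ∑ p ∈ C, w p := Finset.tsum_subtype C w
    _ ≤ ∑ i, w (x i, n) := Finset.sum_image_le_of_nonneg fun _ _ => zero_le
    _ ≤ ∑ i, ENNReal.ofReal
        ((1 / ε) ^ (⨆ y : U i, birkhoffSum T ((-s) • f : C(X, ℝ)) n (y : X))) := by
      refine Finset.sum_le_sum fun i _ => ENNReal.ofReal_le_ofReal ?_
      rw [one_div_rpow_eq_exp h0, Real.exp_le_exp]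
      have h2 := le_iSup_birkhoffSum T ((-s) • f : C(X, ℝ)) n (hx i)
      rw [birkhoffSum_smul] at h2
      have h3 := le_iSup_birkhoffSum T f n (mem_bowenBall_self T n (x i) h0)
      have h4 := mul_le_mul_of_nonneg_left h2 hL.le
      have h5 := mul_le_mul_of_nonneg_left h3 (mul_nonneg hs hL.le)
      linarith
    _ = ENNReal.ofReal (∑ i, (1 / ε) ^ (⨆ y : U i,
        birkhoffSum T ((-s) • f : C(X, ℝ)) n (y : X))) :=
      (ENNReal.ofReal_sum_of_nonneg fun i _ => Real.rpow_nonneg (by positivity) _).symm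
    _ ≤ ENNReal.ofReal r := ENNReal.ofReal_le_ofReal hlt.le

lemma bsMeasure_eq_zero_of_coverGrowth_neg {X : Type*} [MetricSpace X] [CompactSpace X]
    [Nonempty X] {T : X → X} (hT : Continuous T) (f : C(X, ℝ)) {s ε : ℝ} (hs : 0 ≤ s) (h0 : 0 < ε)
    (h1 : ε < 1) (h : coverGrowth T ((-s) • f) ε < 0) :
    bsMeasure T f Set.univ ε (s * Real.log (1 / ε)) = 0 := by
  obtain ⟨c, hc, hc0⟩ := EReal.lt_iff_exists_real_btwn.1 h
  have hc0 : c < 0 := by exact_mod_cast hc0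
  have hev := eventually_lt_of_limsup_lt hc
  refine ENNReal.iSup_eq_zero.2 fun N => ?_
  have hlim : Tendsto (fun n : ℕ => ENNReal.ofReal (Real.exp (n * c))) atTop (𝓝 0) := by
    rw [← ENNReal.ofReal_zero]
    refine ENNReal.tendsto_ofReal (Real.tendsto_exp_atBot.comp ?_)
    exact tendsto_natCast_atTop_atTop.atTop_mul_const_of_neg hc0
  refine le_antisymm (ge_of_tendsto hlim ?_) zero_le
  filter_upwards [hev, eventually_ge_atTop N, eventually_gt_atTop 0] with n hn hNn hn0
  have hn' : (0 : ℝ) < n := by exact_mod_cast hn0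
  refine bsSum_le_ofReal hT f hs h0 h1 hNn ?_
  rw [EReal.coe_lt_coe_iff, div_lt_iff₀' hn'] at hn
  exact (Real.log_lt_iff_lt_exp (coverSum_pos hT _ n h0 h1)).1 hn

lemma bsMdim_le_of_upperMdim_neg {X : Type*} [MetricSpace X] [CompactSpace X] [Nonempty X]
    {T : X → X} (hT : Continuous T) (f : C(X, ℝ)) {s : ℝ} (hs : 0 ≤ s)
    (h : upperMdim T ((-s) • f) < 0) : bsMdim T f Set.univ ≤ s := by
  unfold bsMdim
  refine limsup_le_of_le (by isBoundedDefault) ?_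
  filter_upwards [eventually_scale one_pos, eventually_lt_of_limsup_lt h] with ε ⟨h0, h1⟩ hε
  have hL := log_one_div_pos h0 h1
  rw [EReal.div_lt_iff (EReal.coe_pos.2 hL) (EReal.coe_ne_top _), zero_mul] at hε
  rw [EReal.div_le_iff_le_mul (EReal.coe_pos.2 hL) (EReal.coe_ne_top _), ← EReal.coe_mul,
    mul_comm]
  exact iInf₂_le (s * Real.log (1 / ε)) (bsMeasure_eq_zero_of_coverGrowth_neg hT f hs h0 h1 hε)

/-! ### Covers of a fixed length from covers by Bowen balls of varying length -/

/-- `CoverBound T f t n δ Z A` says that `Z` has a finite open cover by sets `U i` of `d_n`-diameter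
at most `δ` with lower bounds `c i` for the Birkhoff sums `S_n f` on `U i` such that
`∑ i, exp (-t c i) ≤ A`. -/
def CoverBound {X : Type u} [MetricSpace X] (T : X → X) (f : C(X, ℝ)) (t : ℝ) (n : ℕ) (δ : ℝ)
    (Z : Set X) (A : ℝ) : Prop :=
  ∃ (ι : Type u) (_ : Fintype ι) (U : ι → Set X) (c : ι → ℝ), (∀ i, IsOpen (U i)) ∧
    (∀ i, ∀ x ∈ U i, ∀ y ∈ U i, ∀ j < n, dist (T^[j] x) (T^[j] y) ≤ δ) ∧
    (∀ i, ∀ x ∈ U i, c i ≤ birkhoffSum T f n x) ∧ (∀ x ∈ Z, ∃ i, x ∈ U i) ∧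
    ∑ i, Real.exp (-t * c i) ≤ A

lemma CoverBound.mono {X : Type*} [MetricSpace X] {T : X → X} {f : C(X, ℝ)} {t : ℝ} {n : ℕ} {δ : ℝ}
    {Z : Set X} {A B : ℝ} (h : CoverBound T f t n δ Z A) (hAB : A ≤ B) :
    CoverBound T f t n δ Z B := by
  obtain ⟨ι, hι, U, c, h1, h2, h3, h4, h5⟩ := h
  exact ⟨ι, hι, U, c, h1, h2, h3, h4, h5.trans hAB⟩

lemma CoverBound.iUnion {X : Type u} [MetricSpace X] {T : X → X} {f : C(X, ℝ)} {t : ℝ} {n : ℕ}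
    {δ : ℝ} {J : Type u} [Fintype J] {Z : J → Set X} {A : J → ℝ}
    (h : ∀ j, CoverBound T f t n δ (Z j) (A j)) :
    CoverBound T f t n δ (⋃ j, Z j) (∑ j, A j) := by
  choose ι hι U c h1 h2 h3 h4 h5 using h
  refine ⟨Σ j, ι j, inferInstance, fun p => U p.1 p.2, fun p => c p.1 p.2, fun p => h1 _ _,
    fun p => h2 _ _, fun p => h3 _ _, fun x hx => ?_, ?_⟩
  · obtain ⟨j, hj⟩ := Set.mem_iUnion.1 hx
    obtain ⟨i, hi⟩ := h4 j x hj
    exact ⟨⟨j, i⟩, hi⟩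
  · rw [Fintype.sum_sigma]
    exact Finset.sum_le_sum fun j _ => h5 j

/-- A set of `d_n`-diameter at most `δ` is a cover of itself, with the trivial bound `S_n f ≥ 0`. -/
lemma CoverBound.self {X : Type*} [MetricSpace X] {T : X → X} {f : C(X, ℝ)} (hf : ∀ x, 0 ≤ f x)
    {t : ℝ} {n : ℕ} {δ : ℝ} {W : Set X} (hW : IsOpen W)
    (hδ : ∀ x ∈ W, ∀ y ∈ W, ∀ j < n, dist (T^[j] x) (T^[j] y) ≤ δ) :
    CoverBound T f t n δ W 1 :=
  ⟨PUnit, inferInstance, fun _ => W, fun _ => 0, fun _ => hW, fun _ => hδ,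
    fun _ x _ => birkhoffSum_nonneg T hf n x, fun _ hx => ⟨⟨⟩, hx⟩, by simp⟩

/-- Concatenation: orbit segments of length `m` starting in `W` are continued by the members of a cover
for the length `n`. -/
lemma CoverBound.concat {X : Type*} [MetricSpace X] {T : X → X} (hT : Continuous T) {f : C(X, ℝ)}
    {t : ℝ} {m n : ℕ} {δ A b : ℝ} {W : Set X} (hW : IsOpen W)
    (hδ : ∀ x ∈ W, ∀ y ∈ W, ∀ j < m, dist (T^[j] x) (T^[j] y) ≤ δ)
    (hb : ∀ x ∈ W, b ≤ birkhoffSum T f m x) (h : CoverBound T f t n δ Set.univ A) :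
    CoverBound T f t (m + n) δ W (Real.exp (-t * b) * A) := by
  obtain ⟨ι, hι, U, c, h1, h2, h3, h4, h5⟩ := h
  refine ⟨ι, hι, fun i => W ∩ T^[m] ⁻¹' U i, fun i => b + c i,
    fun i => hW.inter ((h1 i).preimage (hT.iterate m)), ?_, ?_, ?_, ?_⟩
  · rintro i x ⟨hx, hxU⟩ y ⟨hy, hyU⟩ j hj
    rcases lt_or_ge j m with hjm | hjm
    · exact hδ x hx y hy j hjm
    · have := h2 i _ hxU _ hyU (j - m) (by omega)
      rwa [← Function.iterate_add_apply, ← Function.iterate_add_apply, Nat.sub_add_cancel hjm]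
        at this
  · rintro i x ⟨hx, hxU⟩
    rw [birkhoffSum_add]
    exact add_le_add (hb x hx) (h3 i _ hxU)
  · intro x hx
    obtain ⟨i, hi⟩ := h4 (T^[m] x) trivial
    exact ⟨i, hx, hi⟩
  · calc ∑ i, Real.exp (-t * (b + c i)) = Real.exp (-t * b) * ∑ i, Real.exp (-t * c i) := by
          simp_rw [mul_add, Real.exp_add, Finset.mul_sum]
      _ ≤ _ := mul_le_mul_of_nonneg_left h5 (Real.exp_pos _).le

/-- A finite cover by sets `W j` with weights `a j` of total at most `1`, where `W j` controls orbit
segments of length `m j`, yields covers for every length `n` with sums `O(exp (θ n))`. Points are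
coded by following the segments until the length `n` is exhausted. The last segment may overshoot; the
constant `∑ j, 1 / a j` pays for it. -/
lemma coverBound_of_weights {X : Type u} [MetricSpace X] {T : X → X} (hT : Continuous T)
    {f : C(X, ℝ)} (hf : ∀ x, 0 ≤ f x) {t θ δ : ℝ} (hθ : 0 ≤ θ) {J : Type u} [Fintype J]
    (W : J → Set X) (m : J → ℕ) (a b : J → ℝ) (hW : ∀ j, IsOpen (W j)) (hm : ∀ j, 0 < m j)
    (hδ : ∀ j, ∀ x ∈ W j, ∀ y ∈ W j, ∀ k < m j, dist (T^[k] x) (T^[k] y) ≤ δ)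
    (hb : ∀ j, ∀ x ∈ W j, b j ≤ birkhoffSum T f (m j) x) (ha : ∀ j, 0 < a j)
    (hab : ∀ j, Real.exp (-t * b j) ≤ a j * Real.exp (θ * m j)) (hsum : ∑ j, a j ≤ 1)
    (hcov : ∀ x, ∃ j, x ∈ W j) (n : ℕ) :
    CoverBound T f t n δ Set.univ ((∑ j, 1 / a j) * Real.exp (θ * n)) := by
  set K := ∑ j, 1 / a j
  have hK : 0 ≤ K := Finset.sum_nonneg fun j _ => (one_div_pos.2 (ha j)).le
  induction n using Nat.strong_induction_on with
  | _ n ih =>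
    have hj : ∀ j, CoverBound T f t n δ (W j) (a j * (K * Real.exp (θ * n))) := by
      intro j
      rcases lt_or_ge (m j) n with hlt | hge
      · have h1 := CoverBound.concat hT (hW j) (hδ j) (hb j) (ih (n - m j) (by
          have := hm j; omega))
        rw [Nat.add_sub_cancel' hlt.le] at h1
        refine h1.mono ((mul_le_mul_of_nonneg_right (hab j)
          (mul_nonneg hK (Real.exp_pos _).le)).trans_eq ?_)
        have : Real.exp (θ * n) = Real.exp (θ * m j) * Real.exp (θ * (n - m j : ℕ)) := by
          rw [← Real.exp_add, Nat.cast_sub hlt.le]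
          ring_nf
        rw [this]
        ring
      · refine (CoverBound.self hf (hW j) fun x hx y hy k hk =>
          hδ j x hx y hy k (hk.trans_le hge)).mono ?_
        have h1 : 1 / a j ≤ K := Finset.single_le_sum (f := fun j => 1 / a j)
          (fun j _ => (one_div_pos.2 (ha j)).le) (Finset.mem_univ j)
        have h2 : 1 ≤ Real.exp (θ * n) := Real.one_le_exp (by positivity)
        calc 1 = a j * (1 / a j * 1) := by rw [mul_one, mul_one_div_cancel (ha j).ne']
          _ ≤ a j * (K * Real.exp (θ * n)) := by
            have := (ha j).le
            gcongr
    have hU := CoverBound.iUnion hj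
    rw [Set.eq_univ_of_forall fun x => Set.mem_iUnion.2 (hcov x)] at hU
    refine hU.mono ?_
    rw [← Finset.sum_mul]
    exact mul_le_of_le_one_left (by positivity) hsum

lemma CoverBound.coverSum_le {X : Type*} [MetricSpace X] {T : X → X} {f : C(X, ℝ)}
    (hf : ∀ x, 0 ≤ f x) {t s δ ε A : ℝ} {n : ℕ} (h0 : 0 < ε) (h1 : ε < 1) (ht : 0 ≤ t)
    (hts : t ≤ s * Real.log (1 / ε)) (hδ : 0 ≤ δ) (hδε : δ < ε)
    (h : CoverBound T f t n δ Set.univ A) : coverSum T ((-s) • f) n ε ≤ A := by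
  obtain ⟨ι, hι, U, c, hU1, hU2, hU3, hU4, hU5⟩ := h
  have hL := log_one_div_pos h0 h1
  refine (MetricMeanDim.coverSum_le h0 h1 hδ hδε U (fun i => -t * c i / Real.log (1 / ε)) hU1 hU2
    (fun x => hU4 x trivial) fun i x hx => ?_).trans ?_
  · rw [birkhoffSum_smul, le_div_iff₀ hL]
    have h2 := mul_le_mul_of_nonneg_left (hU3 i x hx) ht
    have h3 := mul_le_mul_of_nonneg_right hts (birkhoffSum_nonneg T hf n x)
    linarith
  · refine le_trans (le_of_eq (Finset.sum_congr rfl fun i _ => ?_)) hU5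
    rw [one_div_rpow_eq_exp h0, mul_div_cancel₀ _ hL.ne']

lemma coverGrowth_le_of_coverSum_le {X : Type*} [MetricSpace X] [CompactSpace X] [Nonempty X]
    {T : X → X} (hT : Continuous T) {φ : C(X, ℝ)} {ε K θ : ℝ} (h0 : 0 < ε) (h1 : ε < 1)
    (h : ∀ n : ℕ, coverSum T φ n ε ≤ K * Real.exp (θ * n)) : coverGrowth T φ ε ≤ θ := by
  have hK : 0 < K := by
    have := (coverSum_pos hT φ 0 h0 h1).trans_le (h 0)
    simpa using this
  have hlim : Tendsto (fun n : ℕ => ((Real.log K / n + θ : ℝ) : EReal)) atTop (𝓝 θ) := by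
    refine (continuous_coe_real_ereal.tendsto θ).comp ?_
    simpa using (tendsto_const_div_atTop_nhds_zero_nat (Real.log K)).add_const θ
  refine (limsup_le_limsup ?_).trans_eq hlim.limsup_eq
  filter_upwards [eventually_gt_atTop 0] with n hn
  have hn' : (0 : ℝ) < n := by exact_mod_cast hn
  have h2 := Real.log_le_log (coverSum_pos hT φ n h0 h1) (h n)
  rw [Real.log_mul hK.ne' (Real.exp_pos _).ne', Real.log_exp] at h2
  rw [EReal.coe_le_coe_iff, div_le_iff₀ hn', add_mul, div_mul_cancel₀ _ hn'.ne']
  exact h2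

/-! ### Lower bound for the critical exponents -/

lemma exists_bsSum_cover_lt {X : Type*} [MetricSpace X] {T : X → X} {f : C(X, ℝ)} {Z : Set X}
    {ε t : ℝ} (h : bsMeasure T f Z ε t = 0) (N : ℕ) {r : ENNReal} (hr : 0 < r) :
    ∃ C : Set (X × ℕ), (C.Countable ∧ (∀ p ∈ C, N ≤ p.2) ∧ Z ⊆ ⋃ p ∈ C, bowenBall T p.2 p.1 ε) ∧
      ∑' p : C, ENNReal.ofReal
        (Real.exp (-t * ⨆ y : bowenBall T p.1.2 p.1.1 ε, birkhoffSum T f p.1.2 (y : X))) < r := by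
  have h1 : bsSum T f Z ε t N < r := (ENNReal.iSup_eq_zero.1 h N).trans_lt hr
  simpa only [bsSum, iInf_lt_iff, exists_prop] using h1

/-- For a nonnegative potential every weight with exponent `t ≤ 0` is at least `1`. -/
lemma pos_of_bsMeasure_eq_zero {X : Type*} [MetricSpace X] [Nonempty X] {T : X → X}
    {f : C(X, ℝ)} (hf : ∀ x, 0 ≤ f x) {ε t : ℝ} (h : bsMeasure T f Set.univ ε t = 0) : 0 < t := by
  by_contra! ht
  obtain ⟨C, ⟨-, -, hcov⟩, hlt⟩ := exists_bsSum_cover_lt h 0 one_pos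
  obtain ⟨x⟩ := ‹Nonempty X›
  obtain ⟨p, hp, -⟩ := Set.mem_iUnion₂.1 (hcov (Set.mem_univ x))
  refine absurd ((ENNReal.le_tsum (⟨p, hp⟩ : C)).trans_lt hlt) (not_lt.2 ?_)
  rw [ENNReal.one_le_ofReal]
  refine Real.one_le_exp (mul_nonneg (neg_nonneg.2 ht) ?_)
  exact Real.iSup_nonneg fun y => birkhoffSum_nonneg T hf _ _

lemma bsMdim_nonneg {X : Type*} [MetricSpace X] [Nonempty X] {T : X → X}
    {f : C(X, ℝ)} (hf : ∀ x, 0 ≤ f x) : 0 ≤ bsMdim T f Set.univ := by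
  refine le_limsup_of_frequently_le (Eventually.frequently ?_)
  filter_upwards [eventually_scale one_pos] with ε ⟨h0, h1⟩
  refine EReal.div_nonneg ?_ (EReal.coe_nonneg.2 (log_one_div_pos h0 h1).le)
  exact le_iInf₂ fun t ht => EReal.coe_nonneg.2 (pos_of_bsMeasure_eq_zero hf ht).le

lemma exists_finset_cover_of_bsMeasure_eq_zero {X : Type*} [MetricSpace X] [CompactSpace X]
    {T : X → X} (hT : Continuous T) {f : C(X, ℝ)} {ε t : ℝ} (h0 : 0 < ε)
    (h : bsMeasure T f Set.univ ε t = 0) :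
    ∃ J : Finset (X × ℕ), (∀ p ∈ J, 0 < p.2) ∧ (∀ x, ∃ p ∈ J, x ∈ bowenBall T p.2 p.1 ε) ∧
      ∑ p ∈ J, Real.exp (-t * ⨆ y : bowenBall T p.2 p.1 ε, birkhoffSum T f p.2 (y : X)) ≤ 1 := by
  classical
  obtain ⟨C, ⟨-, hN, hcov⟩, hlt⟩ := exists_bsSum_cover_lt h 1 one_pos
  obtain ⟨J, hJ⟩ := isCompact_univ.elim_finite_subcover
    (fun p : C => bowenBall T p.1.2 p.1.1 ε) (fun p => isOpen_bowenBall hT _ _ h0)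
    (by simpa only [Set.iUnion_subtype] using hcov)
  refine ⟨J.image Subtype.val, ?_, fun x => ?_, ?_⟩
  · intro p hp
    obtain ⟨q, -, rfl⟩ := Finset.mem_image.1 hp
    exact hN q q.2
  · obtain ⟨p, hp, hx⟩ := Set.mem_iUnion₂.1 (hJ (Set.mem_univ x))
    exact ⟨p, Finset.mem_image_of_mem _ hp, hx⟩
  · rw [Finset.sum_image Subtype.val_injective.injOn, ← ENNReal.ofReal_le_one,
      ENNReal.ofReal_sum_of_nonneg fun _ _ => (Real.exp_pos _).le]
    exact (ENNReal.sum_le_tsum J).trans hlt.le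

/-- If `f` varies by at most `γ` on sets of diameter less than `2 ε`, then an exponent `t` at which the
outer measure at scale `ε` vanishes bounds the growth rate at the larger scale `3 ε`. -/
lemma coverGrowth_le_of_bsMeasure_eq_zero {X : Type*} [MetricSpace X] [CompactSpace X] [Nonempty X]
    {T : X → X} (hT : Continuous T) {f : C(X, ℝ)} (hf : ∀ x, 0 ≤ f x) {ε γ t s : ℝ} (h0 : 0 < ε)
    (h1 : 3 * ε < 1) (hγ0 : 0 ≤ γ) (hγ : ∀ x y, dist x y < 2 * ε → f x ≤ f y + γ)
    (h : bsMeasure T f Set.univ ε t = 0) (hts : t ≤ s * Real.log (1 / (3 * ε))) :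
    coverGrowth T ((-s) • f) (3 * ε) ≤ ((t * γ : ℝ) : EReal) := by
  have ht := (pos_of_bsMeasure_eq_zero hf h).le
  obtain ⟨J, hJ, hcov, hsum⟩ := exists_finset_cover_of_bsMeasure_eq_zero hT h0 h
  have hclose : ∀ p : X × ℕ, ∀ x ∈ bowenBall T p.2 p.1 ε, ∀ y ∈ bowenBall T p.2 p.1 ε,
      ∀ k < p.2, dist (T^[k] x) (T^[k] y) < 2 * ε := by
    intro p x hx y hy k hk
    have h1 := (bowenDist_lt_iff h0).1 hx k hk
    have h2 := (bowenDist_lt_iff h0).1 hy k hk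
    have := dist_triangle_left (T^[k] x) (T^[k] y) (T^[k] p.1)
    linarith
  let σ : X × ℕ → ℝ := fun p => ⨆ y : bowenBall T p.2 p.1 ε, birkhoffSum T f p.2 (y : X)
  have hσ : ∀ p : X × ℕ, ∀ x ∈ bowenBall T p.2 p.1 ε, σ p - p.2 * γ ≤ birkhoffSum T f p.2 x := by
    intro p x hx
    have : Nonempty (bowenBall T p.2 p.1 ε) := ⟨⟨x, hx⟩⟩
    refine sub_le_iff_le_add.2 (ciSup_le fun y => ?_)
    calc birkhoffSum T f p.2 (y : X) ≤ ∑ k ∈ Finset.range p.2, (f (T^[k] x) + γ) :=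
          Finset.sum_le_sum fun k hk => hγ _ _ (hclose p _ y.2 _ hx k (Finset.mem_range.1 hk))
      _ = birkhoffSum T f p.2 x + p.2 * γ := by simp [birkhoffSum, Finset.sum_add_distrib]
  have hcb := coverBound_of_weights (t := t) (θ := t * γ) (δ := 2 * ε) hT hf (by positivity)
    (J := J) (fun p => bowenBall T p.1.2 p.1.1 ε) (fun p => p.1.2)
    (fun p => Real.exp (-t * σ p)) (fun p => σ p - p.1.2 * γ)
    (fun p => isOpen_bowenBall hT _ _ h0) (fun p => hJ p p.2)
    (fun p x hx y hy k hk => (hclose p x hx y hy k hk).le) (fun p => hσ p)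
    (fun p => Real.exp_pos _)
    (fun p => by rw [← Real.exp_add]; exact le_of_eq (by ring_nf))
    (by rw [Finset.sum_coe_sort J fun p => Real.exp (-t * σ p)]; exact hsum)
    (fun x => by obtain ⟨p, hp, hx⟩ := hcov x; exact ⟨⟨p, hp⟩, hx⟩)
  exact coverGrowth_le_of_coverSum_le hT (by positivity) h1 fun n =>
    (hcb n).coverSum_le hf (by positivity) h1 ht hts (by positivity) (by linarith)

/-- For `s < s'` the factor between `log (1 / ε)` and `log (1 / (3 ε))` is absorbed by the gap between
`s` and `s'`, and the oscillation of `f` at scale `2 ε` tends to `0`. -/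
lemma upperMdim_nonpos_of_bsMdim_lt {X : Type*} [MetricSpace X] [CompactSpace X] [Nonempty X]
    {T : X → X} (hT : Continuous T) {f : C(X, ℝ)} (hf : ∀ x, 0 ≤ f x) {s s' : ℝ} (hs : 0 ≤ s)
    (hss : s < s') (h : bsMdim T f Set.univ < s) {η : ℝ} (hη : 0 < η) :
    upperMdim T ((-s') • f) ≤ ((s' * η : ℝ) : EReal) := by
  have hs' : 0 < s' := hs.trans_lt hss
  obtain ⟨ρ, hρ, hunif⟩ := Metric.uniformContinuous_iff.1
    (CompactSpace.uniformContinuous_of_continuous f.continuous) η hη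
  have hthird : Tendsto (fun ε : ℝ => ε / 3) (𝓝[>] 0) (𝓝[>] 0) := by
    refine tendsto_nhdsWithin_iff.2 ⟨?_, ?_⟩
    · refine tendsto_nhdsWithin_of_tendsto_nhds ?_
      simpa using (continuous_id.div_const (3 : ℝ)).tendsto 0
    · filter_upwards [self_mem_nhdsWithin] with ε hε
      exact div_pos (Set.mem_Ioi.1 hε) three_pos
  have hlog : Tendsto (fun ε : ℝ => Real.log (1 / ε)) (𝓝[>] 0) atTop := by
    simp only [one_div]
    exact Real.tendsto_log_atTop.comp tendsto_inv_nhdsGT_zero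
  unfold upperMdim
  refine limsup_le_of_le (by isBoundedDefault) ?_
  filter_upwards [eventually_scale one_pos, eventually_scale hρ,
    hthird.eventually (eventually_lt_of_limsup_lt h),
    hlog.eventually (eventually_ge_atTop (s * Real.log 3 / (s' - s)))]
    with ε ⟨h0, h1⟩ ⟨_, hερ⟩ hcrit hbig
  have h03 : 0 < ε / 3 := by positivity
  have h3 : 3 * (ε / 3) = ε := by ring
  have hL := log_one_div_pos h0 h1
  have hL3 : Real.log (1 / (ε / 3)) = Real.log (1 / ε) + Real.log 3 := by
    rw [← Real.log_mul (by positivity) (by norm_num)]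
    congr 1
    field_simp
  have hL3pos : 0 < Real.log (1 / (ε / 3)) := log_one_div_pos h03 (by linarith)
  rw [div_le_iff₀ (sub_pos.2 hss)] at hbig
  rw [EReal.div_lt_iff (EReal.coe_pos.2 hL3pos) (EReal.coe_ne_top _), ← EReal.coe_mul] at hcrit
  obtain ⟨t, hcrit⟩ := iInf_lt_iff.1 hcrit
  obtain ⟨ht, htlt⟩ := iInf_lt_iff.1 hcrit
  rw [EReal.coe_lt_coe_iff, hL3] at htlt
  have htle : t ≤ s' * Real.log (1 / ε) := by linarith
  have hgrowth := coverGrowth_le_of_bsMeasure_eq_zero (s := s') hT hf h03 (by rw [h3]; exact h1)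
    hη.le (fun x y hxy => by
      have := (abs_lt.1 (hunif (show dist x y < ρ by linarith))).2
      linarith) ht (by rw [h3]; exact htle)
  rw [h3] at hgrowth
  rw [EReal.div_le_iff_le_mul (EReal.coe_pos.2 hL) (EReal.coe_ne_top _), ← EReal.coe_mul]
  refine hgrowth.trans (EReal.coe_le_coe_iff.2 ?_)
  have := mul_le_mul_of_nonneg_right htle hη.le
  linarith

/-! ### Bowen's equation -/

/-- Bowen's equation: the BS metric mean dimension is the zero of `s ↦ upperMdim T (-s f)`. -/
lemma bsMdim_eq_of_upperMdim_eq_zero {X : Type*} [MetricSpace X] [CompactSpace X] [Nonempty X]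
    {T : X → X} (hT : Continuous T) {f : C(X, ℝ)} (hf : ∀ x, 0 < f x) {s₀ : ℝ} (hs₀ : 0 ≤ s₀)
    (h : upperMdim T ((-s₀) • f) = 0) : bsMdim T f Set.univ = s₀ := by
  obtain ⟨m, M, hm, hM, hb⟩ := exists_pos_bounds f hf
  have hdec := fun s t : ℝ => upperMdim_neg_smul_le (s := s) (t := t) hT fun x => (hb x).1
  refine le_antisymm (EReal.le_of_forall_lt_iff_le.1 fun s hs => ?_) (not_lt.1 fun hlt => ?_)
  · have hs : s₀ < s := by exact_mod_cast hs
    refine bsMdim_le_of_upperMdim_neg hT f (hs₀.trans hs.le) ((hdec s₀ s hs.le).trans_lt ?_)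
    rw [h, zero_add]
    have := mul_pos (sub_pos.2 hs) hm
    exact_mod_cast neg_neg_of_pos this
  · obtain ⟨s, hs, hss⟩ := EReal.lt_iff_exists_real_btwn.1 hlt
    have hss : s < s₀ := by exact_mod_cast hss
    have hs0 : 0 ≤ s := by
      have := (bsMdim_nonneg fun x => (hf x).le).trans hs.le
      exact_mod_cast this
    -- On `[s', s₀]` the function drops by at least `η s₀ > s' η`.
    set s' := (s + s₀) / 2 with hs'
    have hpos : 0 < s₀ := hs0.trans_lt hss
    set η := (s₀ - s') * m / s₀ with hη
    have hd : 0 < (s₀ - s') * m := mul_pos (by linarith) hm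
    have hηpos : 0 < η := div_pos hd hpos
    have h1 := upperMdim_nonpos_of_bsMdim_lt (s' := s') hT (fun x => (hf x).le) hs0 (by linarith) hs
      hηpos
    have h2 := (hdec s' s₀ (by linarith)).trans (add_le_add_left h1 _)
    rw [h, ← EReal.coe_add] at h2
    have h3 : 0 ≤ s' * η + -((s₀ - s') * m) := by exact_mod_cast h2
    have h4 : η * s₀ = (s₀ - s') * m := div_mul_cancel₀ _ hpos.ne'
    have h5 : η * s' < η * s₀ := mul_lt_mul_of_pos_left (by linarith) hηpos
    linarith

end MetricMeanDim

theorem corollary4p6 {X : Type*} [MetricSpace X] [CompactSpace X] [Nonempty X]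
    [MeasurableSpace X] [BorelSpace X] (T : X → X) (hT : Continuous T)
    (hfin : MetricMeanDim.upperMdim T (0 : C(X, ℝ)) < ⊤)
    (f : C(X, ℝ)) (hf : ∀ x, 0 < f x) :
    (∃! s₀ : ℝ, 0 ≤ s₀ ∧ MetricMeanDim.upperMdim T ((-s₀) • f) = 0) ∧
    ∀ s₀ : ℝ, 0 ≤ s₀ → MetricMeanDim.upperMdim T ((-s₀) • f) = 0 →
      ∀ μ ∈ MetricMeanDim.equilibriumStates T ((-s₀) • f),
        MetricMeanDim.bsMdim T f Set.univ =
          MetricMeanDim.measureMdim T μ / ((∫ x, f x ∂(μ : Measure X) : ℝ) : EReal) := by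
  refine ⟨MetricMeanDim.existsUnique_upperMdim_eq_zero hT hfin f hf, fun s₀ hs₀ h μ hμ => ?_⟩
  rw [MetricMeanDim.bsMdim_eq_of_upperMdim_eq_zero hT hf hs₀ h]
  obtain ⟨m, M, hm, -, hb⟩ := MetricMeanDim.exists_pos_bounds f hf
  have hint : Integrable (fun x => f x) (μ : Measure X) :=
    f.continuous.integrable_of_hasCompactSupport (HasCompactSupport.of_compactSpace _)
  have hpos : 0 < ∫ x, f x ∂(μ : Measure X) := by
    have := integral_mono (integrable_const m) hint fun x => (hb x).1
    simp only [integral_const, probReal_univ, one_smul] at this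
    exact hm.trans_le this
  have heq : (0 : EReal) = MetricMeanDim.measureMdim T μ +
      ((∫ x, ((-s₀) • f : C(X, ℝ)) x ∂(μ : Measure X) : ℝ) : EReal) := h ▸ hμ
  simp only [ContinuousMap.smul_apply, smul_eq_mul, integral_const_mul] at heq
  -- The sum is `0`, so the infimum `F(μ)` is a real number.
  generalize MetricMeanDim.measureMdim T μ = F at heq ⊢
  induction F with
  | bot => simp at heq
  | top => exact absurd (heq.trans (EReal.top_add_coe _)) EReal.zero_ne_top
  | coe r =>
    have hr : 0 = r + -s₀ * ∫ x, f x ∂(μ : Measure X) := by exact_mod_cast heq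
    rw [← EReal.coe_div, EReal.coe_eq_coe_iff, eq_div_iff hpos.ne']
    linarith
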